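/- There exists (in ZFC) a subspace $X$ of the Cantor space $2^\omega=\{0,1\}^{\omega}$ (with the product topology of the discrete space $\{0,1\}$) that is homogeneous but not relatively homogeneous. Here a space $X$ is homogeneous if for every pair $(x,y)$ of points of $X$ there is a homeomorphism $h:X\to X$ with $h(x)=y$, and a subspace $X$ of $2^\omega$ is relatively homogeneous if for every pair $(x,y)$ of points of $X$ there is a homeomorphism $h:2^\omega\to 2^\omega$ with $h[X]=X$ and $h(x)=y$. -/

import Mathlib

/-- A topological space is homogeneous if its self-homeomorphisms act transitively on its points. -/
def IsHomogeneousSpace (X : Type*) [TopologicalSpace X] : Prop :=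
  ∀ x y : X, ∃ h : X ≃ₜ X, h x = y

/-- A subset `X` of a space `Z` is relatively homogeneous in `Z` if any point of `X` can be moved to
any other point of `X` by a self-homeomorphism `h` of the whole of `Z` with `h[X] = X`. -/
def IsRelativelyHomogeneous {Z : Type*} [TopologicalSpace Z] (X : Set Z) : Prop :=
  ∀ x ∈ X, ∀ y ∈ X, ∃ h : Z ≃ₜ Z, h '' X = X ∧ h x = y

/-! Work in the square of the group `CantorGroup`. The involution `shear` is continuous wherever the
first coordinate has infinitely many zeros. If a subgroup `H` has no nonzero element with eventually
constant first coordinate, then `shear` maps `H` homeomorphically onto `X = shear '' H`, so `X` is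
homogeneous. On `X`, the translation by `d` in `H`, conjugated by `shear`, involves `zeroParity x -
zeroParity (x + d.1)`, which for `d ≠ 0` has no continuous extension over any nonempty open set
(`exists_ne_zeroParity_sub`). Hence a nontrivial homeomorphism `g` of the square, conjugated by
`shear`, avoids at continuum many points all translations by a small subgroup (`exists_candidates`).
A recursion of length continuum builds `H` from generators `p i`, the `i`-th keeping the conjugate
of the `i`-th homeomorphism from preserving `H`. Only the identity then preserves `X`, which has two
points. -/

open Cardinal Filter Topology

/-! ### Cantor schemes, transfinite choice and spans in 2-groups -/

/-- If `R` is an open relation that separates two points of every nonempty open subset of the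
nonempty open set `U` of a compact Hausdorff space, then `U` contains a family of `R`-separated
points indexed by the Cantor space. -/
theorem exists_separated_cantor_family {X : Type*} [TopologicalSpace X] [CompactSpace X] [T2Space X]
    {R : X → X → Prop} (hsymm : ∀ x y, R x y → R y x)
    (hopen : ∀ x y, R x y → ∃ V ∈ 𝓝 x, ∃ W ∈ 𝓝 y, ∀ a ∈ V, ∀ b ∈ W, R a b)
    {U : Set X} (hU : IsOpen U) (hne : U.Nonempty)
    (hsplit : ∀ V ⊆ U, IsOpen V → V.Nonempty → ∃ x ∈ V, ∃ y ∈ V, R x y) :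
    ∃ φ : (ℕ → Bool) → X, (∀ s, φ s ∈ U) ∧ ∀ s t, s ≠ t → R (φ s) (φ t) := by
  -- Separation is required on closures because the branch limits given by compactness are only
  -- known to lie in closures.
  have key : ∀ V : Set X, V ⊆ U → IsOpen V → V.Nonempty → ∃ C : Bool → Set X,
      (∀ b, IsOpen (C b) ∧ (C b).Nonempty ∧ closure (C b) ⊆ V) ∧
      ∀ x ∈ closure (C false), ∀ y ∈ closure (C true), R x y := by
    intro V hVU hV hVne
    obtain ⟨x, hx, y, hy, hxy⟩ := hsplit V hVU hV hVne
    obtain ⟨P, hP, Q, hQ, hPQ⟩ := hopen x y hxy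
    have shrink : ∀ z ∈ V, ∀ N ∈ 𝓝 z, ∃ C : Set X,
        IsOpen C ∧ C.Nonempty ∧ closure C ⊆ V ∧ closure C ⊆ N := by
      intro z hz N hN
      obtain ⟨K, hK, hKc, hKs⟩ :=
        exists_mem_nhds_isClosed_subset (Filter.inter_mem (hV.mem_nhds hz) hN)
      refine ⟨interior K, isOpen_interior, ⟨z, mem_interior_iff_mem_nhds.2 hK⟩, ?_, ?_⟩ <;>
        refine (closure_minimal interior_subset hKc).trans (hKs.trans ?_)
      exacts [Set.inter_subset_left, Set.inter_subset_right]
    obtain ⟨C0, h0, h0n, h0V, h0P⟩ := shrink x hx P hP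
    obtain ⟨C1, h1, h1n, h1V, h1Q⟩ := shrink y hy Q hQ
    refine ⟨fun b => cond b C1 C0, ?_, fun a ha b hb => hPQ a (h0P ha) b (h1Q hb)⟩
    rintro (_ | _)
    exacts [⟨h0, h0n, h0V⟩, ⟨h1, h1n, h1V⟩]
  let P := {V : Set X // V ⊆ U ∧ IsOpen V ∧ V.Nonempty}
  choose C hC hCR using fun V : P => key V.1 V.2.1 V.2.2.1 V.2.2.2
  let child : P → Bool → P := fun V b =>
    ⟨C V b, subset_closure.trans ((hC V b).2.2.trans V.2.1), (hC V b).1, (hC V b).2.1⟩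
  let D : (ℕ → Bool) → ℕ → P := fun s n =>
    Nat.rec ⟨U, subset_rfl, hU, hne⟩ (fun k V => child V (s k)) n
  have hD : ∀ s n, closure (D s (n + 1)).1 ⊆ (D s n).1 := fun s n => (hC (D s n) (s n)).2.2
  have hlim : ∀ s, ∃ x, ∀ n, x ∈ closure (D s n).1 := by
    intro s
    have := IsCompact.nonempty_iInter_of_sequence_nonempty_isCompact_isClosed
      (fun n => closure (D s n).1) (fun n => (hD s n).trans subset_closure)
      (fun n => (D s n).2.2.2.closure) isClosed_closure.isCompact (fun n => isClosed_closure)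
    obtain ⟨x, hx⟩ := this
    exact ⟨x, fun n => Set.mem_iInter.1 hx n⟩
  choose φ hφ using hlim
  refine ⟨φ, fun s => hD s 0 (hφ s 1), fun s t hst => ?_⟩
  have hex : ∃ n, s n ≠ t n := by
    by_contra! h
    exact hst (funext h)
  classical
  obtain ⟨n, hn, hmin⟩ : ∃ n, s n ≠ t n ∧ ∀ m < n, s m = t m :=
    ⟨Nat.find hex, Nat.find_spec hex, fun m hm => not_not.1 (Nat.find_min hex hm)⟩
  have heq : ∀ m ≤ n, D s m = D t m := by
    intro m
    induction m with
    | zero => intro _; rfl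
    | succ m ih =>
      intro hm
      change child (D s m) (s m) = child (D t m) (t m)
      rw [ih (by omega), hmin m (by omega)]
  have hs : φ s ∈ closure (C (D s n) (s n)) := hφ s (n + 1)
  have ht : φ t ∈ closure (C (D s n) (t n)) := by
    rw [heq n le_rfl]
    exact hφ t (n + 1)
  cases hsn : s n <;> cases htn : t n <;> rw [hsn] at hs <;> rw [htn] at ht
  · exact absurd (hsn.trans htn.symm) hn
  · exact hCR _ _ hs _ ht
  · exact hsymm _ _ (hCR _ _ ht _ hs)
  · exact absurd (hsn.trans htn.symm) hn

/-- Transfinite recursion by choosing, at each stage, a point that is suitable with respect to the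
points chosen before, if there is one. -/
theorem exists_transfinite_choice {ι X : Type*} [LinearOrder ι] [WellFoundedLT ι] [Inhabited X]
    (Q : (i : ι) → (Set.Iio i → X) → X → Prop) :
    ∃ p : ι → X, ∀ i, (∃ x, Q i (fun j => p j) x) → Q i (fun j => p j) (p i) := by
  classical
  let F : (i : ι) → ((j : ι) → j < i → X) → X := fun i ih =>
    if h : ∃ x, Q i (fun j => ih j.1 j.2) x then h.choose else default
  refine ⟨(wellFounded_lt (α := ι)).fix F, fun i h => ?_⟩
  rw [WellFounded.fix_eq]
  simp only [F]
  rw [dif_pos h]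
  exact h.choose_spec

theorem AddSubgroup.mk_closure_lt {G : Type*} [AddGroup G] {S : Set G} {κ : Cardinal}
    (hκ : ℵ₀ < κ) (hS : #S < κ) : #(AddSubgroup.closure S) < κ := by
  have hT : #(S ∪ -S : Set G) < κ := by
    refine (mk_union_le _ _).trans_lt (add_lt_of_lt hκ.le hS ?_)
    rw [← Set.image_neg_eq_neg]
    exact mk_image_le.trans_lt hS
  have hsub : (AddSubgroup.closure S : Set G) ⊆
      Set.range fun l : List (S ∪ -S : Set G) => (l.map Subtype.val).sum := by
    intro x hx
    rw [SetLike.mem_coe, ← AddSubgroup.mem_toAddSubmonoid, AddSubgroup.closure_toAddSubmonoid] at hx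
    obtain ⟨l, hl, rfl⟩ := AddSubmonoid.exists_list_of_mem_closure hx
    refine ⟨l.attach.map fun y => ⟨y.1, hl y.1 y.2⟩, ?_⟩
    simp
  refine (mk_le_mk_of_subset hsub).trans_lt (mk_range_le.trans_lt ((mk_list_le_max _).trans_lt ?_))
  exact max_lt hκ hT

/-- For a family `p` in an elementary abelian 2-group indexed by a well-order, every nonzero element
of the subgroup generated by an initial segment of the family has a leading term. -/
theorem exists_leading_term {G ι : Type*} [AddCommGroup G] (h2 : ∀ x : G, x + x = 0)
    [LinearOrder ι] [WellFoundedLT ι] (p : ι → G) {T : Set ι} (hlow : IsLowerSet T)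
    {x : G} (hx : x ∈ AddSubgroup.closure (p '' T)) (hx0 : x ≠ 0) :
    ∃ k ∈ T, ∃ s ∈ AddSubgroup.closure (p '' Set.Iio k), x = p k + s := by
  have hneg : ∀ x : G, -x = x := fun x => neg_eq_of_add_eq_zero_left (h2 x)
  have step : ∀ T : Set ι, (∀ k ∈ T, ∀ y ∈ AddSubgroup.closure (p '' Set.Iio k), y ≠ 0 →
      ∃ j < k, ∃ s ∈ AddSubgroup.closure (p '' Set.Iio j), y = p j + s) →
      (∀ k ∈ T, Set.Iio k ⊆ T) →
      ∀ y ∈ AddSubgroup.closure (p '' T), y = 0 ∨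
      ∃ j ∈ T, ∃ s ∈ AddSubgroup.closure (p '' Set.Iio j), y = p j + s := by
    intro T hT hlow y hy
    have mono : ∀ j k, j < k → AddSubgroup.closure (p '' Set.Iio j) ≤
        AddSubgroup.closure (p '' Set.Iio k) := fun j k hjk =>
      AddSubgroup.closure_mono (Set.image_mono (Set.Iio_subset_Iio hjk.le))
    have hp : ∀ j k, j < k → p j ∈ AddSubgroup.closure (p '' Set.Iio k) := fun j k hjk =>
      AddSubgroup.subset_closure ⟨j, hjk, rfl⟩
    induction hy using AddSubgroup.closure_induction with
    | mem y hy =>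
      obtain ⟨j, hj, rfl⟩ := hy
      exact Or.inr ⟨j, hj, 0, zero_mem _, by simp⟩
    | zero => exact Or.inl rfl
    | neg y _ ih => rwa [hneg]
    | add y z _ _ ihy ihz =>
      rcases ihy with rfl | ⟨j, hj, s, hs, rfl⟩
      · rwa [zero_add]
      rcases ihz with rfl | ⟨k, hk, t, ht, rfl⟩
      · rw [add_zero]
        exact Or.inr ⟨j, hj, s, hs, rfl⟩
      rcases lt_trichotomy j k with hjk | rfl | hjk
      · exact Or.inr ⟨k, hk, p j + s + t,
          add_mem (add_mem (hp j k hjk) (mono j k hjk hs)) ht, by abel⟩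
      -- Equal leading terms cancel by `h2`, leaving an element of an earlier span, to which the
      -- inductive hypothesis applies.
      · have e : p j + s + (p j + t) = s + t := by
          rw [show p j + s + (p j + t) = (p j + p j) + (s + t) by abel, h2, zero_add]
        rw [e]
        by_cases h0 : s + t = 0
        · exact Or.inl h0
        · obtain ⟨i, hi, r, hr, h⟩ := hT j hj _ (add_mem hs ht) h0
          exact Or.inr ⟨i, hlow j hj hi, r, hr, h⟩
      · exact Or.inr ⟨j, hj, p k + t + s,
          add_mem (add_mem (hp k j hjk) (mono k j hjk ht)) hs, by abel⟩
  have main : ∀ k, ∀ y ∈ AddSubgroup.closure (p '' Set.Iio k), y ≠ 0 →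
      ∃ j < k, ∃ s ∈ AddSubgroup.closure (p '' Set.Iio j), y = p j + s := by
    intro k
    induction k using WellFoundedLT.induction with
    | ind k ih =>
      intro y hy hy0
      exact (step (Set.Iio k) ih (fun j hj => Set.Iio_subset_Iio (le_of_lt hj)) y hy).resolve_left
        hy0
  exact (step T (fun k _ => main k) (fun k hk j hj => hlow (le_of_lt hj) hk) x hx).resolve_left hx0

/-! ### Eventually constant sequences and the shear -/

/-- The elementary abelian 2-group on the Cantor space. -/
abbrev CantorGroup := ℕ → ZMod 2

namespace CantorGroup

theorem add_self (x : CantorGroup) : x + x = 0 :=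
  funext fun n => CharTwo.add_self_eq_zero (x n)

/-- The subgroup of eventually constant sequences. -/
def eventuallyConst : AddSubgroup CantorGroup where
  carrier := {x | ∃ N c, ∀ n ≥ N, x n = c}
  add_mem' := by
    rintro x y ⟨N, c, hN⟩ ⟨M, d, hM⟩
    refine ⟨max N M, c + d, fun n hn => ?_⟩
    rw [Pi.add_apply, hN n (le_of_max_le_left hn), hM n (le_of_max_le_right hn)]
  zero_mem' := ⟨0, 0, fun _ _ => rfl⟩
  neg_mem' := by
    rintro x ⟨N, c, hN⟩
    exact ⟨N, -c, fun n hn => by rw [Pi.neg_apply, hN n hn]⟩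

/-- The sequence that agrees with `x` below `n` and is constantly `a` from `n` on. -/
def truncate (x : CantorGroup) (n : ℕ) (a : ZMod 2) : CantorGroup := fun m => if m < n then x m else a

theorem truncate_mem (x : CantorGroup) (n : ℕ) (a : ZMod 2) : truncate x n a ∈ eventuallyConst :=
  ⟨n, a, fun _ hm => if_neg (not_lt.2 hm)⟩

theorem tendsto_truncate (x : CantorGroup) (a : ZMod 2) :
    Tendsto (fun n => truncate x n a) atTop (𝓝 x) := by
  refine tendsto_pi_nhds.2 fun m => tendsto_const_nhds.congr' ?_
  filter_upwards [eventually_gt_atTop m] with n hn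
  exact (if_pos hn).symm

theorem countable_eventuallyConst : (eventuallyConst : Set CantorGroup).Countable := by
  have : (eventuallyConst : Set CantorGroup) ⊆
      ⋃ N : ℕ, Set.range fun q : (Fin N → ZMod 2) × ZMod 2 =>
        fun n => if h : n < N then q.1 ⟨n, h⟩ else q.2 := by
    rintro x ⟨N, c, hN⟩
    rw [Set.mem_iUnion]
    refine ⟨N, (fun i => x i, c), funext fun n => ?_⟩
    by_cases h : n < N
    · simp [h]
    · simp [h, hN n (not_lt.1 h)]
  exact (Set.countable_iUnion fun N => Set.countable_range _).mono this

/-- A sequence has zeros at arbitrarily large places. -/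
def HasZeros (x : CantorGroup) : Prop := ∀ k, ∃ n, k ≤ n ∧ x n = 0

theorem hasZeros_of_notMem {x : CantorGroup} (hx : x ∉ eventuallyConst) : HasZeros x := by
  intro k
  by_contra! h
  refine hx ⟨k, 1, fun n hn => ?_⟩
  have := h n hn
  generalize x n = a at this
  revert a
  decide

theorem hasZeros_truncate (x : CantorGroup) (n : ℕ) : HasZeros (truncate x n 0) :=
  fun k => ⟨max k n, le_max_left _ _, if_neg (not_lt.2 (le_max_right _ _))⟩

/-- The sequence whose `k`-th term is the parity of the first place from `k` on where `x`
vanishes. -/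
noncomputable def zeroParity (x : CantorGroup) : CantorGroup :=
  -- If `x` has no zero from `k` on, the infimum is the default 0; continuity is claimed only under
  -- `HasZeros`.
  fun k => ((sInf {n | k ≤ n ∧ x n = 0} : ℕ) : ZMod 2)

theorem zeroParity_eq {x : CantorGroup} {k n : ℕ} (hkn : k ≤ n) (hn : x n = 0)
    (h : ∀ m, k ≤ m → m < n → x m ≠ 0) : zeroParity x k = n := by
  refine congrArg (Nat.cast (R := ZMod 2)) (le_antisymm (Nat.sInf_le ⟨hkn, hn⟩) (le_csInf ⟨n, hkn, hn⟩ fun m hm => ?_))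
  by_contra! hlt
  exact h m hm.1 hlt hm.2

/-- Each output term depends only on the input up to its first zero from `k` on, hence is locally
constant. -/
theorem continuousAt_zeroParity {x : CantorGroup} (hx : HasZeros x) :
    ContinuousAt zeroParity x := by
  refine continuousAt_pi.2 fun k => ?_
  have hne : {n | k ≤ n ∧ x n = 0}.Nonempty := hx k
  set N := sInf {n | k ≤ n ∧ x n = 0} with hN
  have hmem : k ≤ N ∧ x N = 0 := Nat.sInf_mem hne
  have hev : ∀ᶠ y in 𝓝 x, ∀ n ∈ Finset.range (N + 1), y n = x n := by
    rw [Filter.eventually_all_finset]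
    intro n _
    have h : ContinuousAt (fun y : CantorGroup => y n) x := (continuous_apply n).continuousAt
    exact h.eventually (p := fun a => a = x n) (mem_nhds_discrete.2 rfl)
  refine tendsto_nhds_of_eventually_eq ?_
  filter_upwards [hev] with y hy
  refine zeroParity_eq hmem.1 ?_ fun m hkm hmN h0 => ?_
  · rw [hy N (by simp), hmem.2]
  · rw [hy m (by simp; omega)] at h0
    exact Nat.notMem_of_lt_sInf hmN ⟨hkm, h0⟩

/-- The involution `(x, y) ↦ (x, y + zeroParity x)`. -/
noncomputable def shear (p : CantorGroup × CantorGroup) : CantorGroup × CantorGroup :=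
  (p.1, p.2 + zeroParity p.1)

theorem shear_shear (p : CantorGroup × CantorGroup) : shear (shear p) = p :=
  Prod.ext rfl (by simp [shear, add_assoc, add_self])

theorem shear_injective : Function.Injective shear :=
  Function.LeftInverse.injective shear_shear

theorem continuousAt_shear {p : CantorGroup × CantorGroup} (hp : HasZeros p.1) :
    ContinuousAt shear p :=
  continuousAt_fst.prodMk
    (continuousAt_snd.add ((continuousAt_zeroParity hp).comp continuousAt_fst))

/-- If `d` is not eventually constant, `zeroParity x - zeroParity (x + d)` does not extend
continuously over any nonempty open set. -/
theorem exists_ne_zeroParity_sub {U : Set (CantorGroup × CantorGroup)} (hU : IsOpen U)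
    (hne : U.Nonempty) {d : CantorGroup} (hd : d ∉ eventuallyConst)
    {F : CantorGroup × CantorGroup → CantorGroup} (hF : Continuous F) :
    ∃ u ∈ U, HasZeros u.1 ∧ HasZeros (u.1 + d) ∧
      F u ≠ zeroParity u.1 - zeroParity (u.1 + d) := by
  by_contra! hcon
  obtain ⟨⟨x, y⟩, hxy⟩ := hne
  have tend : ∀ (x : CantorGroup) a, Tendsto (fun n => (truncate x n a, y)) atTop (𝓝 (x, y)) :=
    fun x a => (tendsto_truncate x a).prodMk_nhds tendsto_const_nhds
  obtain ⟨k, hk⟩ := ((tend x 1).eventually (hU.mem_nhds hxy)).exists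
  -- A sequence with no zero from `k` on, where `zeroParity` jumps; `z + d` still has infinitely
  -- many zeros.
  set z := truncate x k 1 with hz
  have hzero : ∀ m, k ≤ m → z m ≠ 0 := by
    intro m hm
    rw [hz, truncate, if_neg (not_lt.2 hm)]
    decide
  have hzd : z + d ∉ eventuallyConst := fun h =>
    hd ((add_mem_cancel_left (truncate_mem x k 1)).1 h)
  have hlim : Tendsto (fun n => F (truncate z n 0, y) k + zeroParity (truncate z n 0 + d) k) atTop
      (𝓝 (F (z, y) k + zeroParity (z + d) k)) := by
    refine Tendsto.add ?_ ?_
    · exact (((continuous_apply k).comp hF).tendsto _).comp (tend z 0)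
    · have h1 := (continuousAt_zeroParity (hasZeros_of_notMem hzd)).tendsto.comp
        ((tendsto_truncate z 0).add_const d)
      exact ((continuous_apply k).tendsto _).comp h1
  -- The first zero of `truncate z n 0` from `k` on is at `n`, so convergence would force the parity
  -- of `n` to stabilise.
  have hconst : ∀ᶠ n : ℕ in atTop, (n : ZMod 2) = F (z, y) k + zeroParity (z + d) k := by
    have hmem := (tend z 0).eventually (hU.mem_nhds hk)
    filter_upwards [hlim.eventually (mem_nhds_discrete.2 rfl), hmem, eventually_ge_atTop k]
      with n hn hnU hkn
    have hzeros : HasZeros (truncate z n 0 + d) := by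
      refine hasZeros_of_notMem fun h => hd ?_
      exact (add_mem_cancel_left (truncate_mem z n 0)).1 h
    have h1 := congrFun (hcon _ hnU (hasZeros_truncate z n) hzeros) k
    have h2 : zeroParity (truncate z n 0) k = n := by
      refine zeroParity_eq hkn (if_neg (lt_irrefl n)) fun m hkm hmn => ?_
      rw [truncate, if_pos hmn]
      exact hzero m hkm
    rw [hn, h1, Pi.sub_apply, h2, sub_add_cancel]
  obtain ⟨N, hN⟩ := eventually_atTop.1 hconst
  have h1 := hN N le_rfl
  have h2 := hN (N + 1) (Nat.le_succ N)
  rw [← h1, Nat.cast_succ, _root_.add_eq_left] at h2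
  exact one_ne_zero h2

/-! ### Homeomorphisms against sheared translations -/

theorem exists_fst_ne {V : Set (CantorGroup × CantorGroup)} (hV : IsOpen V) (hne : V.Nonempty) :
    ∃ u ∈ V, ∃ v ∈ V, u.1 ≠ v.1 := by
  obtain ⟨⟨x, y⟩, hxy⟩ := hne
  have tend : ∀ a, ∀ᶠ n in atTop, (truncate x n a, y) ∈ V := fun a =>
    ((tendsto_truncate x a).prodMk_nhds tendsto_const_nhds).eventually (hV.mem_nhds hxy)
  obtain ⟨n, h0, h1⟩ := ((tend 0).and (tend 1)).exists
  refine ⟨_, h0, _, h1, fun h => ?_⟩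
  have := congrFun h n
  simp [truncate] at this

/-- A nontrivial homeomorphism `g`, conjugated by `shear`, differs from every translation by an
element of `L` at many points. -/
theorem exists_candidates (g : CantorGroup × CantorGroup ≃ₜ CantorGroup × CantorGroup)
    (hg : ∃ u, g u ≠ u) (L : AddSubgroup (CantorGroup × CantorGroup))
    (hL : ∀ s ∈ L, s ≠ 0 → s.1 ∉ eventuallyConst) :
    ∃ φ : (ℕ → Bool) → CantorGroup × CantorGroup, Function.Injective (fun s => (φ s).1) ∧
      ((Function.Injective fun s => (g (φ s)).1 - (φ s).1) ∨
        ∀ s, shear (g (φ s)) - shear (φ s) ∉ L) := by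
  have open_ne : ∀ {f : CantorGroup × CantorGroup → CantorGroup}, Continuous f → ∀ u v, f u ≠ f v →
      ∃ V ∈ 𝓝 u, ∃ W ∈ 𝓝 v, ∀ a ∈ V, ∀ b ∈ W, f a ≠ f b := by
    intro f hf u v huv
    obtain ⟨V, W, hV, hW, hu, hv, hd⟩ := t2_separation huv
    exact ⟨f ⁻¹' V, (hV.preimage hf).mem_nhds hu, f ⁻¹' W, (hW.preimage hf).mem_nhds hv,
      fun a ha b hb => hd.ne_of_mem ha hb⟩
  by_cases h : ∃ U : Set (CantorGroup × CantorGroup), IsOpen U ∧ U.Nonempty ∧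
      ∀ u ∈ U, shear (g u) - shear u ∉ L
  · obtain ⟨U, hU, hne, hUL⟩ := h
    obtain ⟨φ, hφU, hφ⟩ := exists_separated_cantor_family (R := fun u v => u.1 ≠ v.1)
      (fun _ _ => Ne.symm) (open_ne continuous_fst) hU hne
      (fun V _ hV hVne => exists_fst_ne hV hVne)
    exact ⟨φ, fun s t hst => by_contra fun hne => hφ s t hne hst, Or.inr fun s => hUL _ (hφU s)⟩
  push Not at h
  have hcont : Continuous fun u => (g u).1 - u.1 := by fun_prop
  obtain ⟨φ, -, hφ⟩ := exists_separated_cantor_family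
    (R := fun u v => u.1 ≠ v.1 ∧ (g u).1 - u.1 ≠ (g v).1 - v.1) (U := {u | g u ≠ u})
    (fun _ _ h => ⟨h.1.symm, h.2.symm⟩)
    (fun u v huv => by
      obtain ⟨V, hV, W, hW, hVW⟩ := open_ne continuous_fst u v huv.1
      obtain ⟨V', hV', W', hW', hVW'⟩ := open_ne hcont u v huv.2
      exact ⟨V ∩ V', inter_mem hV hV', W ∩ W', inter_mem hW hW',
        fun a ha b hb => ⟨hVW a ha.1 b hb.1, hVW' a ha.2 b hb.2⟩⟩)
    (isOpen_ne_fun g.continuous continuous_id) hg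
    (fun V hVU hV hVne => by
      by_contra! hcon
      obtain ⟨u₀, hu₀⟩ := hVne
      have hconst : ∀ u ∈ V, (g u).1 - u.1 = (g u₀).1 - u₀.1 := by
        intro u hu
        -- Points sharing a first coordinate are compared through a third point of `V`.
        by_cases huu : u.1 = u₀.1
        · obtain ⟨v, hv, hvu⟩ : ∃ v ∈ V, v.1 ≠ u.1 := by
            obtain ⟨a, ha, b, hb, hab⟩ := exists_fst_ne hV ⟨u₀, hu₀⟩
            by_cases hau : a.1 = u.1
            exacts [⟨b, hb, fun hbu => hab (hau.trans hbu.symm)⟩, ⟨a, ha, hau⟩]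
          exact (hcon u hu v hv hvu.symm).trans (hcon v hv u₀ hu₀ (huu ▸ hvu))
        · exact hcon u hu u₀ hu₀ huu
      generalize (g u₀).1 - u₀.1 = d₁ at hconst
      have hfst : ∀ u ∈ V, (shear (g u) - shear u).1 = d₁ := hconst
      by_cases hd₁ : d₁ ∈ eventuallyConst
      · obtain ⟨u, hu, huL⟩ := h V hV ⟨u₀, hu₀⟩
        have h0 : shear (g u) - shear u = 0 := by
          by_contra h0
          exact hL _ huL h0 (by rwa [hfst u hu])
        exact hVU hu (shear_injective (sub_eq_zero.1 h0))
      obtain ⟨u, hu, huL⟩ := h V hV ⟨u₀, hu₀⟩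
      set d := shear (g u) - shear u with hd
      have hd1 : d.1 = d₁ := hfst u hu
      obtain ⟨v, hv, hv0, hv1, hne⟩ := exists_ne_zeroParity_sub hV ⟨u₀, hu₀⟩ hd₁
        (F := fun u => (g u).2 - u.2 - d.2) (by fun_prop)
      have hgv : (g v).1 = v.1 + d₁ := sub_eq_iff_eq_add'.1 (hconst v hv)
      have hvd : shear (g v) - shear v ≠ d := by
        intro heq
        refine hne ?_
        have h2 := congrArg Prod.snd heq
        simp only [shear, Prod.snd_sub, hgv] at h2
        simp only [← h2]
        abel
      have hca : ContinuousAt (fun w => shear (g w) - shear w) v :=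
        (ContinuousAt.comp (continuousAt_shear (by rwa [hgv])) g.continuous.continuousAt).sub
          (continuousAt_shear hv0)
      obtain ⟨O, hOs, hO, hvO⟩ :=
        mem_nhds_iff.1 (inter_mem (hV.mem_nhds hv) (hca.eventually_ne hvd))
      -- Both `d` and the displacement at `w` lie in `L` with first coordinate `d₁`; their
      -- difference is nonzero with first coordinate 0, against `hL`.
      obtain ⟨w, hw, hwL⟩ := h O hO ⟨v, hvO⟩
      refine hL _ (sub_mem hwL huL) (sub_ne_zero.2 (hOs hw).2) ?_
      rw [Prod.fst_sub, hfst w (hOs hw).1, hd1, sub_self]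
      exact zero_mem _)
  exact ⟨φ, fun s t hst => by_contra fun hne => (hφ s t hne).1 hst,
    Or.inl fun s t hst => by_contra fun hne => (hφ s t hne).2 hst⟩

/-- The successor step of the recursion: `L` is the span so far and `Q` the points to be kept out of
`H`. Each requirement excludes fewer than continuum many indices of the family from
`exists_candidates`. -/
theorem exists_next_point (g : CantorGroup × CantorGroup ≃ₜ CantorGroup × CantorGroup)
    (hg : ∃ u, g u ≠ u) (L : AddSubgroup (CantorGroup × CantorGroup))
    (hL : ∀ s ∈ L, s ≠ 0 → s.1 ∉ eventuallyConst) (hLc : #L < 𝔠)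
    (Q : Set (CantorGroup × CantorGroup)) (hQ : #Q < 𝔠) :
    ∃ p : CantorGroup × CantorGroup, (∀ s ∈ L, p.1 + s.1 ∉ eventuallyConst) ∧
      (∀ q ∈ Q, q - p ∉ L) ∧ shear (g (shear p)) ∉ L ∧ shear (g (shear p)) - p ∉ L := by
  obtain ⟨φ, hφ, hφL⟩ := exists_candidates g hg L hL
  have small : ∀ {Y : Type} (f : (ℕ → Bool) → Y), Function.Injective f → ∀ B : Set Y, #B < 𝔠 →
      #(f ⁻¹' B) < 𝔠 := fun f hf B hB => (mk_preimage_of_injective f B hf).trans_lt hB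
  have himg : ∀ {Y Y' : Type} (f : Y → Y') (B : Set Y), #B < 𝔠 → #(f '' B) < 𝔠 :=
    fun f B hB => mk_image_le.trans_lt hB
  have himg2 : ∀ {Y Y' Y'' : Type} (f : Y → Y' → Y'') (B : Set Y) (B' : Set Y'),
      #B < 𝔠 → #B' < 𝔠 → #(Set.image2 f B B') < 𝔠 := by
    intro Y Y' Y'' f B B' hB hB'
    rw [← Set.image_uncurry_prod]
    refine himg _ _ ?_
    rw [mk_setProd]
    simpa using mul_lt_of_lt aleph0_le_continuum hB hB'
  have hφi : Function.Injective φ := fun s t h => hφ (congrArg Prod.fst h)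
  have hD : #(eventuallyConst : Set CantorGroup) < 𝔠 :=
    (le_aleph0_iff_set_countable.2 countable_eventuallyConst).trans_lt aleph0_lt_continuum
  set B₁ : Set (ℕ → Bool) := (fun s => (φ s).1) ⁻¹'
    Set.image2 (fun c s => c - s) eventuallyConst (Prod.fst '' (L : Set (CantorGroup × CantorGroup)))
  set B₂ : Set (ℕ → Bool) := (fun s => shear (φ s)) ⁻¹' Set.image2 (fun q s => q - s) Q L
  set B₃ : Set (ℕ → Bool) := (fun s => shear (g (φ s))) ⁻¹' L
  set B₄ : Set (ℕ → Bool) := {s | shear (g (φ s)) - shear (φ s) ∈ L}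
  have h₁ : #B₁ < 𝔠 := small _ hφ _ (himg2 _ _ _ hD (himg _ _ hLc))
  have h₂ : #B₂ < 𝔠 := small _ (shear_injective.comp hφi) _ (himg2 _ _ _ hQ hLc)
  have h₃ : #B₃ < 𝔠 := small _ (shear_injective.comp (g.injective.comp hφi)) _ hLc
  have h₄ : #B₄ < 𝔠 := by
    rcases hφL with hinj | hnot
    · refine (mk_le_mk_of_subset ?_).trans_lt (small _ hinj _ (himg Prod.fst (L : Set (CantorGroup × CantorGroup)) hLc))
      exact fun s hs => ⟨_, hs, rfl⟩
    · have : B₄ = ∅ := Set.eq_empty_of_forall_notMem hnot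
      rw [this, mk_eq_zero]
      exact continuum_pos
  have hu : ∀ {B B' : Set (ℕ → Bool)}, #B < 𝔠 → #B' < 𝔠 → #(B ∪ B' : Set _) < 𝔠 :=
    fun hB hB' => (mk_union_le _ _).trans_lt (add_lt_of_lt aleph0_le_continuum hB hB')
  obtain ⟨s, hs⟩ : ∃ s, s ∉ (B₁ ∪ B₂) ∪ (B₃ ∪ B₄) := by
    by_contra! hall
    have := hu (hu h₁ h₂) (hu h₃ h₄)
    rw [Set.eq_univ_of_forall hall, mk_univ] at this
    simp at this
  simp only [Set.mem_union, not_or] at hs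
  obtain ⟨⟨n₁, n₂⟩, n₃, n₄⟩ := hs
  refine ⟨shear (φ s), fun t ht h => n₁ ⟨_, h, t.1, ⟨t, ht, rfl⟩, ?_⟩,
    fun q hq h => n₂ ⟨q, hq, _, h, ?_⟩, ?_, ?_⟩
  · simp [shear]
  · simp
  · rwa [shear_shear]
  · rwa [shear_shear]

/-! ### The transfinite construction of the subgroup -/

theorem mk_nontrivial_homeomorph_le :
    #{g : CantorGroup × CantorGroup ≃ₜ CantorGroup × CantorGroup // ∃ u, g u ≠ u} ≤ 𝔠 := by
  have hA : #CantorGroup = 𝔠 := by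
    have h2 : #(ZMod 2) = 2 := (mk_fintype _).trans (by rw [ZMod.card]; norm_num)
    rw [← power_def, h2, mk_nat, two_power_aleph0]
  have hG : #(ℕ → CantorGroup × CantorGroup) = 𝔠 := by
    rw [← power_def, mk_prod, lift_id, hA, continuum_mul_self, mk_nat,
      continuum_power_aleph0]
  rw [← hG]
  refine mk_le_of_injective (f := fun g n => g.1 (TopologicalSpace.denseSeq _ n)) ?_
  intro g g' h
  refine Subtype.ext (Homeomorph.ext (congrFun ?_))
  refine Continuous.ext_on (TopologicalSpace.denseRange_denseSeq _) g.1.continuous g'.1.continuous ?_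
  rintro _ ⟨n, rfl⟩
  exact congrFun h n

theorem nontrivial_homeomorph :
    ∃ g : CantorGroup × CantorGroup ≃ₜ CantorGroup × CantorGroup, ∃ u, g u ≠ u := by
  refine ⟨Homeomorph.addLeft (1, 0), 0, fun h => ?_⟩
  have := congrFun (congrArg Prod.fst h) 0
  simp at this

/-- There is a subgroup of `CantorGroup × CantorGroup`, on which `shear` is continuous, whose image
under `shear` is preserved by no nontrivial homeomorphism of `CantorGroup × CantorGroup`. -/
theorem exists_addSubgroup : ∃ H : AddSubgroup (CantorGroup × CantorGroup),
    (∀ s ∈ H, s ≠ 0 → s.1 ∉ eventuallyConst) ∧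
    ∀ g : CantorGroup × CantorGroup ≃ₜ CantorGroup × CantorGroup, (∃ u, g u ≠ u) →
      ∃ p ∈ H, p ≠ 0 ∧ shear (g (shear p)) ∉ H := by
  let ι := Cardinal.ord.{0} 𝔠 |>.ToType
  obtain ⟨g, hg⟩ : ∃ g : ι → {g : CantorGroup × CantorGroup ≃ₜ CantorGroup × CantorGroup //
      ∃ u, g u ≠ u}, Function.Surjective g := by
    obtain ⟨f⟩ := (mk_nontrivial_homeomorph_le.trans_eq (mk_ord_toType 𝔠).symm)
    have : Nonempty {g : CantorGroup × CantorGroup ≃ₜ CantorGroup × CantorGroup //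
      ∃ u, g u ≠ u} := ⟨_, nontrivial_homeomorph.choose_spec⟩
    exact ⟨Function.invFun f, Function.invFun_surjective f.injective⟩
  let q : ι → CantorGroup × CantorGroup → CantorGroup × CantorGroup :=
    fun i x => shear ((g i).1 (shear x))
  let Q : (i : ι) → (Set.Iio i → CantorGroup × CantorGroup) → CantorGroup × CantorGroup → Prop :=
    fun i f x => (∀ s ∈ AddSubgroup.closure (Set.range f), x.1 + s.1 ∉ eventuallyConst) ∧
      (∀ j : Set.Iio i, q j (f j) - x ∉ AddSubgroup.closure (Set.range f)) ∧
      q i x ∉ AddSubgroup.closure (Set.range f) ∧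
      q i x - x ∉ AddSubgroup.closure (Set.range f)
  obtain ⟨p, hp⟩ := exists_transfinite_choice Q
  have h2 : ∀ x : CantorGroup × CantorGroup, x + x = 0 := fun x =>
    Prod.ext (add_self x.1) (add_self x.2)
  have hrange : ∀ i, (Set.range fun j : Set.Iio i => p j) = p '' Set.Iio i := fun i =>
    (Set.image_eq_range p (Set.Iio i)).symm
  have good : ∀ T : Set ι, IsLowerSet T → (∀ j ∈ T, Q j (fun k => p k) (p j)) →
      ∀ s ∈ AddSubgroup.closure (p '' T), s ≠ 0 → s.1 ∉ eventuallyConst := by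
    intro T hT hQ s hs hs0
    obtain ⟨k, hk, t, ht, rfl⟩ := exists_leading_term h2 p hT hs hs0
    rw [← hrange] at ht
    exact (hQ k hk).1 t ht
  -- A suitable point exists only if the earlier choices were suitable, hence the induction.
  have hQ : ∀ i, Q i (fun k => p k) (p i) := by
    intro i
    induction i using WellFoundedLT.induction with
    | ind i ih =>
      refine hp i ?_
      have hlt : #(Set.Iio i) < 𝔠 :=
        (mk_Iio_lt i (by rw [mk_ord_toType, Ordinal.type_toType])).trans_eq (mk_ord_toType 𝔠)
      obtain ⟨x, hx₁, hx₂, hx₃, hx₄⟩ := exists_next_point (g i).1 (g i).2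
        (AddSubgroup.closure (Set.range fun j : Set.Iio i => p j))
        (by rw [hrange]; exact good _ (isLowerSet_Iio i) ih)
        (AddSubgroup.mk_closure_lt aleph0_lt_continuum (mk_range_le.trans_lt hlt))
        (Set.range fun j : Set.Iio i => q j (p j)) (mk_range_le.trans_lt hlt)
      exact ⟨x, hx₁, fun j => hx₂ _ ⟨j, rfl⟩, hx₃, hx₄⟩
  simp only [Q, hrange] at hQ
  have hmem : ∀ {j k}, j < k → p j ∈ AddSubgroup.closure (p '' Set.Iio k) := fun {j k} hjk =>
    AddSubgroup.subset_closure ⟨j, hjk, rfl⟩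
  refine ⟨AddSubgroup.closure (p '' Set.univ),
    good _ isLowerSet_univ fun j _ => by simpa only [Q, hrange] using hQ j, fun h hh => ?_⟩
  obtain ⟨i, hi⟩ := hg ⟨h, hh⟩
  have hqi : ∀ x, shear (h (shear x)) = q i x := by
    intro x
    simp only [q, hi]
  refine ⟨p i, AddSubgroup.subset_closure ⟨i, trivial, rfl⟩, fun h0 => ?_, fun hH => ?_⟩
  · refine (hQ i).1 0 (zero_mem _) ?_
    rw [h0]
    exact zero_mem eventuallyConst
  · rw [hqi] at hH
    obtain ⟨-, -, hq, hqs⟩ := hQ i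
    obtain ⟨k, -, s, hs, hks⟩ := exists_leading_term h2 p isLowerSet_univ hH
      (fun h0 => hq (h0 ▸ zero_mem _))
    have mono : ∀ {j l}, j < l → AddSubgroup.closure (p '' Set.Iio j) ≤
        AddSubgroup.closure (p '' Set.Iio l) := fun {j l} hjl =>
      AddSubgroup.closure_mono (Set.image_mono (Set.Iio_subset_Iio hjl.le))
    -- The leading index `k` of `q i (p i)` is excluded at stage `i` if `k ≤ i`, and at stage `k` if
    -- `k > i`.
    rcases lt_trichotomy k i with hki | rfl | hik
    · exact hq (hks ▸ add_mem (hmem hki) (mono hki hs))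
    · exact hqs (by rwa [hks, add_sub_cancel_left])
    · refine (hQ k).2.1 (⟨i, hik⟩ : Set.Iio k) ?_
      rwa [hks, add_sub_cancel_left]

end CantorGroup

/-! ### Rigid embedding and transfer to the Cantor space -/

open CantorGroup in
theorem exists_homogeneous_rigidly_embedded :
    ∃ X : Set (CantorGroup × CantorGroup), IsHomogeneousSpace X ∧ X.Nontrivial ∧
      ∀ h : CantorGroup × CantorGroup ≃ₜ CantorGroup × CantorGroup, h '' X = X → ∀ u, h u = u := by
  obtain ⟨H, hH, hg⟩ := exists_addSubgroup
  have hzeros : ∀ s ∈ H, HasZeros s.1 := by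
    intro s hs
    by_cases h0 : s = 0
    · rw [h0]
      exact fun k => ⟨k, le_rfl, rfl⟩
    · exact hasZeros_of_notMem (hH s hs h0)
  have hX : ∀ x ∈ shear '' (H : Set (CantorGroup × CantorGroup)), shear x ∈ H := by
    rintro _ ⟨s, hs, rfl⟩
    rwa [shear_shear]
  let E : H ≃ₜ (shear '' (H : Set (CantorGroup × CantorGroup)) : Set (CantorGroup × CantorGroup)) :=
    { toFun := fun s => ⟨shear s, s, s.2, rfl⟩
      invFun := fun x => ⟨shear x, hX x x.2⟩
      left_inv := fun s => Subtype.ext (shear_shear s)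
      right_inv := fun x => Subtype.ext (shear_shear x)
      continuous_toFun := by
        refine Continuous.subtype_mk (continuous_iff_continuousAt.2 fun s => ?_) _
        exact ContinuousAt.comp (continuousAt_shear (hzeros s s.2)) continuousAt_subtype_val
      continuous_invFun := by
        refine Continuous.subtype_mk (continuous_iff_continuousAt.2 fun x => ?_) _
        refine ContinuousAt.comp (continuousAt_shear ?_) continuousAt_subtype_val
        exact hzeros (shear x) (hX x x.2) }
  refine ⟨shear '' (H : Set (CantorGroup × CantorGroup)), fun x y => ?_, ?_, fun h hh => ?_⟩
  -- Translations of `H`, carried over by `E`, act transitively.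
  · refine ⟨(E.symm.trans (Homeomorph.addLeft (E.symm y - E.symm x))).trans E, ?_⟩
    simp
  · obtain ⟨g, hu⟩ := nontrivial_homeomorph
    obtain ⟨p, hp, hp0, -⟩ := hg g hu
    exact ⟨_, ⟨p, hp, rfl⟩, _, ⟨0, zero_mem H, rfl⟩, shear_injective.ne hp0⟩
  · by_contra! hne
    obtain ⟨p, hp, -, hpH⟩ := hg h hne
    refine hpH (hX _ ?_)
    rw [← hh]
    exact ⟨_, ⟨p, hp, rfl⟩, rfl⟩

/-- The Cantor space is homeomorphic to the square of its group version. -/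
noncomputable def cantorHomeomorph : (ℕ → Bool) ≃ₜ CantorGroup × CantorGroup :=
  have hcard : Fintype.card Bool = Fintype.card (ZMod 2) := rfl
  let e : Bool ≃ₜ ZMod 2 := ⟨Fintype.equivOfCardEq hcard, by fun_prop, by fun_prop⟩
  ((Homeomorph.piCongrRight fun _ => e).trans
    (Homeomorph.piCongrLeft (Y := fun _ => ZMod 2) Equiv.natSumNatEquivNat).symm).trans
    Homeomorph.sumArrowHomeomorphProdArrow

/-- Some homogeneous subspace of the Cantor space with more than one point is preserved by no
homeomorphism of the Cantor space but the identity. -/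
theorem exists_homogeneous_cantor_rigidly_embedded :
    ∃ X : Set (ℕ → Bool), IsHomogeneousSpace X ∧ X.Nontrivial ∧
      ∀ h : (ℕ → Bool) ≃ₜ (ℕ → Bool), h '' X = X → ∀ u, h u = u := by
  obtain ⟨Y, hY, hnt, hrigid⟩ := exists_homogeneous_rigidly_embedded
  let e := cantorHomeomorph.symm
  refine ⟨e '' Y, fun x y => ?_, hnt.image e.injective, fun h hh u => ?_⟩
  · let E := e.image Y
    obtain ⟨k, hk⟩ := hY (E.symm x) (E.symm y)
    exact ⟨(E.symm.trans k).trans E, by simp [hk]⟩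
  · have := hrigid ((e.trans h).trans e.symm) (by
      change (fun y => e.symm (h (e y))) '' Y = Y
      rw [← Set.image_image e.symm, ← Set.image_image h, hh, Set.image_image]
      simp) (e.symm u)
    simpa using this

theorem corollary3p2 :
    ∃ X : Set (ℕ → Bool), IsHomogeneousSpace X ∧ ¬ IsRelativelyHomogeneous X := by
  obtain ⟨X, hX, ⟨x, hx, y, hy, hxy⟩, hrigid⟩ := exists_homogeneous_cantor_rigidly_embedded
  refine ⟨X, hX, fun hrel => ?_⟩
  obtain ⟨h, hhX, hh⟩ := hrel x hx y hy
  exact hxy ((hrigid h hhX x).symm.trans hh)
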